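/- Let $m\ge 0$, $N\ge 1$, let $\|\cdot\|$ be an arbitrary norm on $\mathbb{R}^m$ with dual norm $\|z\|_*=\sup_{\|\xi\|\le 1}\langle z,\xi\rangle$, and let $\Xi=\{\xi\in\mathbb{R}^m: C\xi\le d\}$ be a (possibly unbounded) polytope, where $C$ is a real matrix and $d$ a real vector. Let $\widehat\xi_1,\dots,\widehat\xi_N\in\Xi$, let $\widehat{\mathbb P}_N=\frac1N\sum_{i=1}^N\delta_{\widehat\xi_i}$, and let $\varepsilon\ge 0$. Let $\mathcal M(\Xi)$ be the set of Borel probability distributions $\mathbb Q$ on $\mathbb{R}^m$ supported on $\Xi$ with $\int\|\xi\|\,\mathbb Q(d\xi)<\infty$, let $d_W(\mathbb Q_1,\mathbb Q_2)$ be the infimum of $\int\|\xi_1-\xi_2\|\,\Pi(d\xi_1,d\xi_2)$ over all joint distributions $\Pi$ with marginals $\mathbb Q_1$ and $\mathbb Q_2$, and let $\mathbb B_\varepsilon(\widehat{\mathbb P}_N)=\{\mathbb Q\in\mathcal M(\Xi): d_W(\widehat{\mathbb P}_N,\mathbb Q)\le\varepsilon\}$. Let $A$ be a real matrix with $K$ rows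 $a_1,\dots,a_K\in\mathbb{R}^m$ and let $b\in\mathbb{R}^K$. Vector inequalities are componentwise. (i) Let $\mathcal A=\{\xi\in\mathbb{R}^m: A\xi<b\}$. If $K\ge1$ and, for every $k\le K$, the halfspace $\{\xi:\langle a_k,\xi\rangle\ge b_k\}$ has a nonempty intersection with $\Xi$, then the worst-case probability $\sup_{\mathbb Q\in\mathbb B_\varepsilon(\widehat{\mathbb P}_N)}\mathbb Q[\xi\notin\mathcal A]$ equals $$ \left\{\begin{array}{cll} \inf\limits_{\lambda,s_i,\gamma_{ik},\theta_{ik}} & \lambda\varepsilon+\frac1N\sum_{i=1}^N s_i\\ \text{s.t.} & 1-\theta_{ik}\big(b_k-\langle a_k,\widehat\xi_i\rangle\big)+\langle\gamma_{ik},d-C\widehat\xi_i\rangle\le s_i & \forall i\le N,\ k\le K\\ & \|a_k\theta_{ik}-C^\top\gamma_{ik}\|_*\le\lambda & \forall i\le N,\ k\le K\\ & \gamma_{ik}\ge0,\ \theta_{ik}\ge0 & \forall i\le N,\ k\le K\\ & s_i\ge0 & \forall i\le N. \end{array}\right. $$ (ii) Let $\mathcal A=\{\xi\in\mathbb{R}^m: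 A\xi\le b\}$. If $\mathcal A$ has a nonempty intersection with $\Xi$, then the best-case probability $\sup_{\mathbb Q\in\mathbb B_\varepsilon(\widehat{\mathbb P}_N)}\mathbb Q[\xi\in\mathcal A]$ equals $$ \left\{\begin{array}{cll} \inf\limits_{\lambda,s_i,\gamma_i,\theta_i} & \lambda\varepsilon+\frac1N\sum_{i=1}^N s_i\\ \text{s.t.} & 1+\langle\theta_i,b-A\widehat\xi_i\rangle+\langle\gamma_i,d-C\widehat\xi_i\rangle\le s_i & \forall i\le N\\ & \|A^\top\theta_i+C^\top\gamma_i\|_*\le\lambda & \forall i\le N\\ & \gamma_i\ge0,\ \theta_i\ge0,\ s_i\ge0 & \forall i\le N. \end{array}\right. $$ -/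

import Mathlib

open MeasureTheory Matrix
open scoped ENNReal

namespace WassersteinUQ

noncomputable section

/-- The dual norm `‖z‖_* = sup {⟨z, ξ⟩ : ‖ξ‖ ≤ 1}` of a norm on `ℝ^m`. -/
def dualNorm {m : ℕ} (nrm : Seminorm ℝ (Fin m → ℝ)) (z : Fin m → ℝ) : ℝ :=
  sSup ((fun ξ : Fin m → ℝ => z ⬝ᵥ ξ) '' {ξ | nrm ξ ≤ 1})

/-- The closed polyhedron `{ξ : C ξ ≤ d}` (componentwise inequality). -/
def closedPolytope {m J : ℕ} (C : Matrix (Fin J) (Fin m) ℝ) (d : Fin J → ℝ) :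
    Set (Fin m → ℝ) :=
  {ξ | ∀ j, (C *ᵥ ξ) j ≤ d j}

/-- The open polyhedron `{ξ : A ξ < b}` (componentwise strict inequality). -/
def openPolytope {m K : ℕ} (A : Matrix (Fin K) (Fin m) ℝ) (b : Fin K → ℝ) :
    Set (Fin m → ℝ) :=
  {ξ | ∀ k, (A *ᵥ ξ) k < b k}

/-- The empirical distribution, uniform on the samples `ξ̂_1, …, ξ̂_N`. -/
def empirical {m N : ℕ} (ξhat : Fin N → Fin m → ℝ) : Measure (Fin m → ℝ) :=
  (N : ℝ≥0∞)⁻¹ • ∑ i, Measure.dirac (ξhat i)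

/-- The set of Borel probability distributions supported on `Ξ` with finite first moment. -/
def finiteMoment {m : ℕ} (nrm : Seminorm ℝ (Fin m → ℝ)) (Ξ : Set (Fin m → ℝ)) :
    Set (Measure (Fin m → ℝ)) :=
  {Q | IsProbabilityMeasure Q ∧ Q Ξᶜ = 0 ∧ ∫⁻ ξ, ENNReal.ofReal (nrm ξ) ∂Q < ∞}

/-- The joint distributions with marginals `Q₁` and `Q₂`. -/
def couplings {m : ℕ} (Q₁ Q₂ : Measure (Fin m → ℝ)) :
    Set (Measure ((Fin m → ℝ) × (Fin m → ℝ))) :=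
  {P | P.map Prod.fst = Q₁ ∧ P.map Prod.snd = Q₂}

/-- The (type-1) Wasserstein distance with respect to the given norm. -/
def wasserstein {m : ℕ} (nrm : Seminorm ℝ (Fin m → ℝ)) (Q₁ Q₂ : Measure (Fin m → ℝ)) :
    ℝ≥0∞ :=
  ⨅ P ∈ couplings Q₁ Q₂, ∫⁻ p, ENNReal.ofReal (nrm (p.1 - p.2)) ∂P

/-- The Wasserstein ball of radius `ε` around `P`, within the distributions on `Ξ`. -/
def wassersteinBall {m : ℕ} (nrm : Seminorm ℝ (Fin m → ℝ)) (Ξ : Set (Fin m → ℝ))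
    (P : Measure (Fin m → ℝ)) (ε : ℝ) : Set (Measure (Fin m → ℝ)) :=
  {Q | Q ∈ finiteMoment nrm Ξ ∧ wasserstein nrm P Q ≤ ENNReal.ofReal ε}

/-- The supremum of the probability of the event `S` over the Wasserstein ball of radius `ε`
around the empirical distribution. -/
def supProb {m N : ℕ} (nrm : Seminorm ℝ (Fin m → ℝ)) (Ξ : Set (Fin m → ℝ))
    (ξhat : Fin N → Fin m → ℝ) (ε : ℝ) (S : Set (Fin m → ℝ)) : EReal :=
  ⨆ Q ∈ wassersteinBall nrm Ξ (empirical ξhat) ε, ((Q S : ℝ≥0∞) : EReal)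

/-- The constraints of the program for the worst-case probability. -/
structure WorstFeasible {m N J K : ℕ} (nrm : Seminorm ℝ (Fin m → ℝ))
    (C : Matrix (Fin J) (Fin m) ℝ) (d : Fin J → ℝ)
    (A : Matrix (Fin K) (Fin m) ℝ) (b : Fin K → ℝ) (ξhat : Fin N → Fin m → ℝ)
    (lam : ℝ) (s : Fin N → ℝ) (γ : Fin N → Fin K → Fin J → ℝ) (θ : Fin N → Fin K → ℝ) :
    Prop where
  epigraph : ∀ i k,
    1 - θ i k * (b k - A k ⬝ᵥ ξhat i) + γ i k ⬝ᵥ (d - C *ᵥ ξhat i) ≤ s i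
  slope : ∀ i k, dualNorm nrm (θ i k • A k - Cᵀ *ᵥ γ i k) ≤ lam
  γ_nonneg : ∀ i k j, 0 ≤ γ i k j
  θ_nonneg : ∀ i k, 0 ≤ θ i k
  s_nonneg : ∀ i, 0 ≤ s i

/-- The optimal value of the program for the worst-case probability. -/
def worstValue {m N J K : ℕ} (nrm : Seminorm ℝ (Fin m → ℝ))
    (C : Matrix (Fin J) (Fin m) ℝ) (d : Fin J → ℝ)
    (A : Matrix (Fin K) (Fin m) ℝ) (b : Fin K → ℝ) (ξhat : Fin N → Fin m → ℝ)
    (ε : ℝ) : EReal :=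
  ⨅ (lam : ℝ) (s : Fin N → ℝ) (γ : Fin N → Fin K → Fin J → ℝ) (θ : Fin N → Fin K → ℝ)
    (_ : WorstFeasible nrm C d A b ξhat lam s γ θ),
    ((lam * ε + 1 / (N : ℝ) * ∑ i, s i : ℝ) : EReal)

/-- The constraints of the program for the best-case probability. -/
structure BestFeasible {m N J K : ℕ} (nrm : Seminorm ℝ (Fin m → ℝ))
    (C : Matrix (Fin J) (Fin m) ℝ) (d : Fin J → ℝ)
    (A : Matrix (Fin K) (Fin m) ℝ) (b : Fin K → ℝ) (ξhat : Fin N → Fin m → ℝ)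
    (lam : ℝ) (s : Fin N → ℝ) (γ : Fin N → Fin J → ℝ) (θ : Fin N → Fin K → ℝ) :
    Prop where
  epigraph : ∀ i,
    1 + θ i ⬝ᵥ (b - A *ᵥ ξhat i) + γ i ⬝ᵥ (d - C *ᵥ ξhat i) ≤ s i
  slope : ∀ i, dualNorm nrm (Aᵀ *ᵥ θ i + Cᵀ *ᵥ γ i) ≤ lam
  γ_nonneg : ∀ i j, 0 ≤ γ i j
  θ_nonneg : ∀ i k, 0 ≤ θ i k
  s_nonneg : ∀ i, 0 ≤ s i

/-- The optimal value of the program for the best-case probability. -/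
def bestValue {m N J K : ℕ} (nrm : Seminorm ℝ (Fin m → ℝ))
    (C : Matrix (Fin J) (Fin m) ℝ) (d : Fin J → ℝ)
    (A : Matrix (Fin K) (Fin m) ℝ) (b : Fin K → ℝ) (ξhat : Fin N → Fin m → ℝ)
    (ε : ℝ) : EReal :=
  ⨅ (lam : ℝ) (s : Fin N → ℝ) (γ : Fin N → Fin J → ℝ) (θ : Fin N → Fin K → ℝ)
    (_ : BestFeasible nrm C d A b ξhat lam s γ θ),
    ((lam * ε + 1 / (N : ℝ) * ∑ i, s i : ℝ) : EReal)

end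

end WassersteinUQ

open WassersteinUQ

/-!
Weak duality: for a price `λ ≥ 0` of transport, `λ ‖x - ξ‖` plus the Kantorovich potential at `x`
dominates the indicator function of the event at `ξ`, and integrating against a coupling bounds the
probability. The bound is tight: it suffices to move a fraction `p i ∈ [0, 1]` of each atom `ξhat i`
to the nearest point of the event, and the best choice of `p` under the transport budget is a
fractional knapsack problem, whose linear programming dual produces `λ` and the `s i`.

This leaves the semi-infinite constraints `1 - λ ‖ξhat i - ξ‖ ≤ s i` for all `ξ` in a polyhedron.
By the Mazur–Orlicz theorem a sublinear function that dominates a linear one on a polyhedral cone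
dominates, on the whole space, that linear function plus some linear function nonnegative on the
cone, and Farkas' lemma writes the latter as a nonnegative combination of the constraints.
Homogenizing extends this from cones to polyhedra, empty ones included, and the multipliers are
`γ` and `θ`.
-/

namespace WassersteinUQ

section Farkas

variable {𝕜 V ι : Type*} [Field 𝕜] [LinearOrder 𝕜] [IsStrictOrderedRing 𝕜] [AddCommGroup V]
  [Module 𝕜 V]

theorem nonneg_of_mem_hull {s : Set (Module.Dual 𝕜 V)} {f : Module.Dual 𝕜 V} {y : V}
    (hs : ∀ g ∈ s, 0 ≤ g y) (hf : f ∈ PointedCone.hull 𝕜 s) : 0 ≤ f y :=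
  Submodule.span_induction (p := fun f _ => 0 ≤ f y) hs le_rfl (fun _ _ _ _ => add_nonneg)
    (fun r _ _ => mul_nonneg r.2) hf

/-- `f ↦ f - (f y / a y) • a`, the precomposition with the projection of `V` onto the kernel of `a`
along `y`. It eliminates the constraint `a` in the induction that proves Farkas' lemma. It is the
identity if `a y = 0`. -/
def projAlong (a : Module.Dual 𝕜 V) (y : V) : Module.Dual 𝕜 V →ₗ[𝕜] Module.Dual 𝕜 V :=
  LinearMap.id - (Module.Dual.eval 𝕜 V y).smulRight ((a y)⁻¹ • a)

theorem projAlong_apply (a f : Module.Dual 𝕜 V) (x y : V) :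
    projAlong a y f x = f (x - (a x / a y) • y) := by
  simp only [projAlong, LinearMap.sub_apply, LinearMap.id_apply, LinearMap.smulRight_apply,
    Module.Dual.eval_apply, LinearMap.smul_apply, smul_eq_mul, map_sub, map_smul]
  ring

theorem mem_hull_insert_of_projAlong_mem {s : Set (Module.Dual 𝕜 V)} {a c : Module.Dual 𝕜 V}
    {y : V} (hs : ∀ f ∈ s, 0 ≤ f y) (ha : a y < 0) (hc : c y ≤ 0)
    (h : projAlong a y c ∈ PointedCone.hull 𝕜 (projAlong a y '' s)) :
    c ∈ PointedCone.hull 𝕜 (insert a s) := by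
  have hmap : projAlong a y c ∈ (PointedCone.hull 𝕜 s).map (projAlong a y) := by
    rwa [PointedCone.map, PointedCone.hull, Submodule.map_span]
  obtain ⟨g, hg, hgc⟩ := PointedCone.mem_map.1 hmap
  have hcoef : 0 ≤ (c y - g y) / a y :=
    div_nonneg_of_nonpos (by linarith [nonneg_of_mem_hull hs hg]) ha.le
  refine Submodule.mem_span_insert.2 ⟨⟨_, hcoef⟩, g, hg, LinearMap.ext fun x => ?_⟩
  have hx := LinearMap.congr_fun hgc x
  simp only [projAlong_apply, map_sub, map_smul, smul_eq_mul] at hx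
  change c x = (c y - g y) / a y * a x + g x
  linear_combination -hx

theorem mem_hull_image_of_forall_nonneg (t : Finset ι) (a : ι → Module.Dual 𝕜 V)
    (c : Module.Dual 𝕜 V) (h : ∀ x, (∀ i ∈ t, 0 ≤ a i x) → 0 ≤ c x) :
    c ∈ PointedCone.hull 𝕜 (a '' t) := by
  classical
  induction t using Finset.induction_on generalizing a c with
  | empty =>
    have hc : c = 0 := LinearMap.ext fun x =>
      le_antisymm (by simpa using h (-x) (by simp)) (h x (by simp))
    exact hc ▸ zero_mem _
  | insert j t _ ih =>
    rw [Finset.coe_insert, Set.image_insert_eq]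
    by_cases hc : ∀ x, (∀ i ∈ t, 0 ≤ a i x) → 0 ≤ c x
    · exact Submodule.span_mono (Set.subset_insert _ _) (ih a c hc)
    push Not at hc
    obtain ⟨y, hy, hcy⟩ := hc
    have hjy : a j y < 0 := by
      by_contra! hjy
      exact hcy.not_ge (h y ((Finset.forall_mem_insert ..).2 ⟨hjy, hy⟩))
    refine mem_hull_insert_of_projAlong_mem (Set.forall_mem_image.2 hy) hjy hcy.le ?_
    rw [← Set.image_comp]
    refine ih (projAlong (a j) y ∘ a) _ fun x hx => ?_
    simp only [Function.comp_apply, projAlong_apply] at hx ⊢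
    exact h _ ((Finset.forall_mem_insert ..).2 ⟨by simp [hjy.ne], hx⟩)

theorem exists_sum_smul_eq_of_forall_nonneg [Fintype ι] (a : ι → Module.Dual 𝕜 V)
    (c : Module.Dual 𝕜 V) (h : ∀ x, (∀ i, 0 ≤ a i x) → 0 ≤ c x) :
    ∃ μ : ι → 𝕜, 0 ≤ μ ∧ ∑ i, μ i • a i = c := by
  have hc := mem_hull_image_of_forall_nonneg Finset.univ a c fun x hx =>
    h x fun i => hx i (Finset.mem_univ i)
  rw [Finset.coe_univ, Set.image_univ] at hc
  obtain ⟨μ, hμ⟩ := (Submodule.mem_span_range_iff_exists_fun _).1 hc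
  exact ⟨fun i => μ i, fun i => (μ i).2, hμ⟩

end Farkas

section Sublinear

variable {V : Type*} [AddCommGroup V] [Module ℝ V] {q : V → ℝ}

theorem map_zero_of_pos_homogeneous (q_hom : ∀ r : ℝ, 0 < r → ∀ x, q (r • x) = r * q x) :
    q 0 = 0 := by
  have h := q_hom 2 two_pos 0
  rw [smul_zero] at h
  linarith

/-- The **Mazur–Orlicz theorem** for a convex cone. -/
theorem exists_dual_between_of_le_on_cone (q_hom : ∀ r : ℝ, 0 < r → ∀ x, q (r • x) = r * q x)
    (q_add : ∀ x y, q (x + y) ≤ q x + q y) (K : PointedCone ℝ V) (l : Module.Dual ℝ V)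
    (h : ∀ x ∈ K, l x ≤ q x) : ∃ g : Module.Dual ℝ V, (∀ x ∈ K, l x ≤ g x) ∧ ∀ x, g x ≤ q x := by
  have hbdd : ∀ x, BddBelow (Set.range fun k : K => q (x + k) - l k) := fun x => by
    refine ⟨-q (-x), Set.forall_mem_range.2 fun k => ?_⟩
    have hk := q_add (-x) (x + k)
    rw [neg_add_cancel_left] at hk
    linarith [h k k.2]
  -- Hahn–Banach applies to the largest sublinear `q' ≤ q` with `q' (-k) ≤ -l k` on `K`.
  let q' : V → ℝ := fun x => ⨅ k : K, (q (x + k) - l k)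
  have q'_le : ∀ x, ∀ k ∈ K, q' x ≤ q (x + k) - l k := fun x k hk => ciInf_le (hbdd x) ⟨k, hk⟩
  have q'_smul_le : ∀ r : ℝ, 0 < r → ∀ x, q' (r • x) ≤ r * q' x := fun r hr x => by
    rw [Real.mul_iInf_of_nonneg hr.le]
    refine le_ciInf fun k => (q'_le _ _ (K.smul_mem hr.le k.2)).trans_eq ?_
    rw [← smul_add, q_hom r hr, map_smul, smul_eq_mul, mul_sub]
  have q'_hom : ∀ r : ℝ, 0 < r → ∀ x, q' (r • x) = r * q' x := fun r hr x => by
    refine (q'_smul_le r hr x).antisymm ?_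
    have hinv := q'_smul_le r⁻¹ (inv_pos.2 hr) (r • x)
    rwa [inv_smul_smul₀ hr.ne', le_inv_mul_iff₀ hr] at hinv
  have q'_add : ∀ x y, q' (x + y) ≤ q' x + q' y := fun x y => by
    refine le_ciInf_add_ciInf fun k k' => (q'_le _ _ (add_mem k.2 k'.2)).trans ?_
    have hkk' := q_add (x + k) (y + k')
    rw [add_add_add_comm] at hkk'
    rw [map_add]
    linarith
  have q'_zero : 0 ≤ q' 0 := le_ciInf fun k => by simpa using h k k.2
  obtain ⟨g, -, hg⟩ := exists_extension_of_le_sublinear ⊥ q' q'_hom q'_add fun x => by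
    obtain rfl : x = 0 := Subtype.ext ((Submodule.mem_bot ℝ).1 x.2)
    simpa using q'_zero
  refine ⟨g, fun x hx => ?_, fun x => ?_⟩
  · have hgx := (hg (-x)).trans (q'_le (-x) x hx)
    rw [neg_add_cancel, map_zero_of_pos_homogeneous q_hom, map_neg] at hgx
    linarith
  · simpa using (hg x).trans (q'_le x 0 (zero_mem K))

variable {ι : Type*} [Fintype ι]

theorem exists_multipliers_of_le_sublinear (q_hom : ∀ r : ℝ, 0 < r → ∀ x, q (r • x) = r * q x)
    (q_add : ∀ x y, q (x + y) ≤ q x + q y) (a : ι → Module.Dual ℝ V) (l : Module.Dual ℝ V)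
    (h : ∀ x, (∀ i, 0 ≤ a i x) → l x ≤ q x) :
    ∃ μ : ι → ℝ, 0 ≤ μ ∧ ∀ x, l x + ∑ i, μ i * a i x ≤ q x := by
  let K : PointedCone ℝ V :=
    ⨅ i, (PointedCone.positive ℝ ℝ).comap (a i)
  have mem_K : ∀ x, x ∈ K ↔ ∀ i, 0 ≤ a i x := fun x => by simp [K, Submodule.mem_iInf]
  obtain ⟨g, hlg, hgq⟩ := exists_dual_between_of_le_on_cone q_hom q_add K l fun x hx =>
    h x ((mem_K x).1 hx)
  obtain ⟨μ, hμ, hsum⟩ := exists_sum_smul_eq_of_forall_nonneg a (g - l) fun x hx =>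
    sub_nonneg.2 (hlg x ((mem_K x).2 hx))
  refine ⟨μ, hμ, fun x => ?_⟩
  have hx := LinearMap.congr_fun hsum x
  simp only [LinearMap.sum_apply, LinearMap.smul_apply, smul_eq_mul, LinearMap.sub_apply] at hx
  linarith [hgq x]

theorem exists_multipliers_of_le_sublinear_on_polyhedron
    (q_hom : ∀ r : ℝ, 0 < r → ∀ x, q (r • x) = r * q x) (q_add : ∀ x y, q (x + y) ≤ q x + q y)
    (a : ι → Module.Dual ℝ V) (h : ι → ℝ) (l : Module.Dual ℝ V) (c : ℝ)
    (h_rec : ∀ x, (∀ i, 0 ≤ a i x) → l x ≤ q x)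
    (h_le : ∀ x, (∀ i, 0 ≤ a i x + h i) → l x + c ≤ q x) :
    ∃ μ : ι → ℝ, 0 ≤ μ ∧ (∀ x, l x + ∑ i, μ i * a i x ≤ q x) ∧ c + ∑ i, μ i * h i ≤ 0 := by
  have h_hom : ∀ x t, 0 ≤ t → (∀ i, 0 ≤ a i x + h i * t) → l x + c * t ≤ q x := by
    intro x t ht hx
    obtain rfl | ht := ht.eq_or_lt
    · simpa using h_rec x (by simpa using hx)
    have hle := h_le (t⁻¹ • x) fun i => by
      rw [map_smul, smul_eq_mul, ← mul_inv_cancel_right₀ ht.ne' (h i), mul_comm _ t⁻¹, ← mul_add]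
      exact mul_nonneg (inv_nonneg.2 ht.le) (hx i)
    rw [q_hom _ (inv_pos.2 ht), map_smul, smul_eq_mul, le_inv_mul_iff₀ ht, mul_add,
      mul_inv_cancel_left₀ ht.ne', mul_comm t] at hle
    exact hle
  -- The homogenization in `V × ℝ`; the multiplier `none` belongs to the constraint `0 ≤ t`.
  obtain ⟨μ, hμ, hle⟩ := exists_multipliers_of_le_sublinear (V := V × ℝ) (q := fun x => q x.1)
    (fun r hr x => q_hom r hr x.1) (fun x y => q_add x.1 y.1)
    (fun o : Option ι => o.elim (.snd ℝ V ℝ) fun i => (a i).coprod (h i • .id))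
    (l.coprod (c • .id)) fun x hx => by
      simpa using h_hom x.1 x.2 (by simpa using hx none) fun i => by simpa using hx (some i)
  have h_split : ∀ x t, l x + c * t + (μ none * t + ∑ i, μ (some i) * (a i x + h i * t)) ≤ q x :=
    fun x t => by simpa [Fintype.sum_option] using hle (x, t)
  refine ⟨fun i => μ (some i), fun i => hμ _, fun x => by simpa using h_split x 0, ?_⟩
  have h_one := h_split 0 1
  simp only [map_zero, mul_one, zero_add, map_zero_of_pos_homogeneous q_hom] at h_one
  linarith [show 0 ≤ μ none from hμ none]

end Sublinear

section Knapsack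

variable {ι : Type*} [Fintype ι]

/-- The feasible set of the fractional knapsack problem with weights `w` and capacity `R`. -/
def knapsack (w : ι → ℝ) (R : ℝ) : Set (ι → ℝ) :=
  {p ∈ Set.Icc 0 1 | w ⬝ᵥ p ≤ R}

theorem exists_isMaxOn_knapsack (v w : ι → ℝ) {R : ℝ} (hR : 0 ≤ R) :
    ∃ p ∈ knapsack w R, IsMaxOn (v ⬝ᵥ ·) (knapsack w R) p := by
  have hcompact : IsCompact (knapsack w R) :=
    isCompact_Icc.inter_right
      (isClosed_le (continuous_const.dotProduct continuous_id) continuous_const)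
  exact hcompact.exists_isMaxOn ⟨0, by simpa [knapsack] using hR⟩
    (continuous_const.dotProduct continuous_id).continuousOn

theorem exists_knapsack_dual_le (v w : ι → ℝ) {R : ℝ} (hR : 0 ≤ R) :
    ∃ p ∈ knapsack w R, ∃ lam : ℝ, 0 ≤ lam ∧ ∃ s : ι → ℝ, 0 ≤ s ∧
      (∀ i, v i - lam * w i ≤ s i) ∧ lam * R + ∑ i, s i ≤ v ⬝ᵥ p := by
  obtain ⟨p, hp, hmax⟩ := exists_isMaxOn_knapsack v w hR
  refine ⟨p, hp, ?_⟩
  -- The constraints are `w ⬝ᵥ x ≤ R`, `x i ≤ 1` and `0 ≤ x i`.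
  obtain ⟨μ, hμ, hle, hval⟩ := exists_multipliers_of_le_sublinear_on_polyhedron
    (q := 0) (by simp) (by simp)
    (Sum.elim (fun _ : Unit => -dotProductBilin ℝ ℝ w)
      (Sum.elim (fun i => -LinearMap.proj i) fun i => LinearMap.proj i))
    (Sum.elim (fun _ => R) (Sum.elim 1 0)) (dotProductBilin ℝ ℝ v) (-(v ⬝ᵥ p))
    (fun x hx => by
      obtain rfl : x = 0 := funext fun i =>
        le_antisymm (by simpa using hx (.inr (.inl i))) (hx (.inr (.inr i)))
      simp)
    (fun x hx => by
      have hx_mem : x ∈ knapsack w R :=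
        ⟨⟨fun i => by simpa using hx (.inr (.inr i)), fun i => by simpa using hx (.inr (.inl i))⟩,
          by simpa using hx (.inl ())⟩
      simpa using hmax hx_mem)
  refine ⟨μ (.inl ()), hμ _, fun i => μ (.inr (.inl i)), fun i => hμ _, fun i => ?_, ?_⟩
  · classical
    have hi : v i + (-(μ (.inl ()) * w i) + (-μ (.inr (.inl i)) + μ (.inr (.inr i)))) ≤ 0 := by
      simpa [Fintype.sum_sum_type, Pi.single_apply] using hle (Pi.single i 1)
    linarith [show 0 ≤ μ (.inr (.inr i)) from hμ _]
  · have hval' : -(v ⬝ᵥ p) + (μ (.inl ()) * R + ∑ i, μ (.inr (.inl i))) ≤ 0 := by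
      simpa only [Fintype.sum_sum_type, Fintype.sum_unique, Sum.elim_inl, Sum.elim_inr,
        Pi.one_apply, Pi.zero_apply, mul_one, mul_zero, Finset.sum_const_zero, add_zero] using hval
    linarith

end Knapsack

section Norm

variable {E : Type*} [NormedAddCommGroup E] [NormedSpace ℝ E] [FiniteDimensional ℝ E]
  {p : Seminorm ℝ E}

theorem continuous_seminorm (p : Seminorm ℝ E) : Continuous p :=
  continuousOn_univ.1 (p.convexOn.continuousOn isOpen_univ)

theorem exists_pos_mul_norm_le_seminorm (hp : ∀ x, p x = 0 → x = 0) :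
    ∃ c > 0, ∀ x, c * ‖x‖ ≤ p x := by
  have hpos : ∀ x ∈ Metric.sphere (0 : E) 1, 0 < p x := fun x hx =>
    (apply_nonneg p x).lt_of_ne' fun h => Metric.ne_of_mem_sphere hx one_ne_zero (hp x h)
  obtain ⟨c, hc, hle⟩ := (isCompact_sphere (0 : E) 1).exists_forall_le'
    (continuous_seminorm p).continuousOn hpos
  refine ⟨c, hc, fun x => ?_⟩
  obtain rfl | hx := eq_or_ne x 0
  · simp
  have hx' := hle (‖x‖⁻¹ • x) (by simp [norm_smul, hx])
  rwa [map_smul_eq_mul, norm_inv, norm_norm, le_inv_mul_iff₀ (norm_pos_iff.2 hx), mul_comm] at hx'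

theorem exists_isMinOn_seminorm_sub (hp : ∀ x, p x = 0 → x = 0) {T : Set E} (hT : IsClosed T)
    (hne : T.Nonempty) (x : E) : ∃ y ∈ T, IsMinOn (fun y => p (x - y)) T y := by
  obtain ⟨c, hc, hle⟩ := exists_pos_mul_norm_le_seminorm hp
  have hcoercive : Filter.Tendsto (fun y => p (x - y)) (Filter.cocompact E) Filter.atTop :=
    Filter.tendsto_atTop_mono (fun y => by rw [dist_eq_norm]; exact hle (x - y))
      ((tendsto_dist_left_cocompact_atTop x).const_mul_atTop hc)
  obtain ⟨y₀, hy₀⟩ := hne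
  exact ContinuousOn.exists_isMinOn' ((continuous_seminorm p).comp
    (continuous_const.sub continuous_id)).continuousOn hT hy₀
    (Filter.Eventually.filter_mono inf_le_left (hcoercive.eventually_ge_atTop _))

end Norm

section DualNorm

variable {m : ℕ} {nrm : Seminorm ℝ (Fin m → ℝ)} {z : Fin m → ℝ}

theorem bddAbove_dualNorm (hnrm : ∀ ξ, nrm ξ = 0 → ξ = 0) (z : Fin m → ℝ) :
    BddAbove ((fun ξ => z ⬝ᵥ ξ) '' {ξ | nrm ξ ≤ 1}) := by
  obtain ⟨c, hc, hle⟩ := exists_pos_mul_norm_le_seminorm hnrm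
  have hball : {ξ | nrm ξ ≤ 1} ⊆ Metric.closedBall 0 c⁻¹ := fun ξ hξ =>
    mem_closedBall_zero_iff.2 ((le_inv_mul_iff₀ hc).2 ((hle ξ).trans hξ) |>.trans_eq (mul_one _))
  exact ((isCompact_closedBall 0 c⁻¹).bddAbove_image
    (continuous_const.dotProduct continuous_id).continuousOn).mono (Set.image_mono hball)

theorem dualNorm_nonneg (hnrm : ∀ ξ, nrm ξ = 0 → ξ = 0) (z : Fin m → ℝ) :
    0 ≤ dualNorm nrm z :=
  le_csSup (bddAbove_dualNorm hnrm z) ⟨0, by simp, by simp⟩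

theorem dotProduct_le_dualNorm_mul (hnrm : ∀ ξ, nrm ξ = 0 → ξ = 0) (z ξ : Fin m → ℝ) :
    z ⬝ᵥ ξ ≤ dualNorm nrm z * nrm ξ := by
  obtain h0 | hpos := (apply_nonneg nrm ξ).eq_or_lt'
  · simp [hnrm ξ h0]
  have hunit : nrm ((nrm ξ)⁻¹ • ξ) = 1 := by
    rw [map_smul_eq_mul, Real.norm_of_nonneg (inv_nonneg.2 hpos.le), inv_mul_cancel₀ hpos.ne']
  have hle : z ⬝ᵥ ((nrm ξ)⁻¹ • ξ) ≤ dualNorm nrm z :=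
    le_csSup (bddAbove_dualNorm hnrm z) ⟨_, hunit.le, rfl⟩
  rwa [dotProduct_smul, smul_eq_mul, inv_mul_le_iff₀ hpos, mul_comm] at hle

theorem dualNorm_le_iff (hnrm : ∀ ξ, nrm ξ = 0 → ξ = 0) {lam : ℝ} (hlam : 0 ≤ lam) :
    dualNorm nrm z ≤ lam ↔ ∀ ξ, z ⬝ᵥ ξ ≤ lam * nrm ξ := by
  refine ⟨fun h ξ => (dotProduct_le_dualNorm_mul hnrm z ξ).trans <|
    mul_le_mul_of_nonneg_right h (apply_nonneg _ _), fun h => csSup_le ⟨_, 0, by simp, rfl⟩ ?_⟩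
  rintro _ ⟨ξ, hξ, rfl⟩
  exact (h ξ).trans (mul_le_of_le_one_right hlam hξ)

theorem dualNorm_neg (nrm : Seminorm ℝ (Fin m → ℝ)) (z : Fin m → ℝ) :
    dualNorm nrm (-z) = dualNorm nrm z := by
  rw [dualNorm, dualNorm, ← (Function.Involutive.surjective neg_neg).image_preimage {ξ | nrm ξ ≤ 1}]
  simp [Set.image_image]

end DualNorm

section PolyhedralDuality

variable {m : ℕ} {nrm : Seminorm ℝ (Fin m → ℝ)} {ι : Type*} [Fintype ι]

theorem forall_mulVec_le_iff_exists_dualNorm_le (hnrm : ∀ ξ, nrm ξ = 0 → ξ = 0)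
    (M : Matrix ι (Fin m) ℝ) (h : ι → ℝ) (x : Fin m → ℝ) {lam s : ℝ} (hlam : 0 ≤ lam) :
    (∀ ξ, M *ᵥ ξ ≤ h → 1 - lam * nrm (x - ξ) ≤ s) ↔
      ∃ γ : ι → ℝ, 0 ≤ γ ∧ 1 + γ ⬝ᵥ (h - M *ᵥ x) ≤ s ∧ dualNorm nrm (Mᵀ *ᵥ γ) ≤ lam := by
  have transpose_dot : ∀ γ ξ, (Mᵀ *ᵥ γ) ⬝ᵥ ξ = γ ⬝ᵥ (M *ᵥ ξ) := fun γ ξ => by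
    rw [mulVec_transpose, dotProduct_mulVec]
  simp only [dualNorm_le_iff hnrm hlam, transpose_dot]
  constructor
  · intro hs
    -- In terms of `w = x - ξ` the constraint reads `0 ≤ M *ᵥ w + (h - M *ᵥ x)`.
    obtain ⟨γ, hγ, hle, hval⟩ := exists_multipliers_of_le_sublinear_on_polyhedron
      (q := fun w => lam * nrm w)
      (fun r hr w => by rw [map_smul_eq_mul, Real.norm_of_nonneg hr.le, mul_left_comm])
      (fun w w' => by rw [← mul_add]; exact mul_le_mul_of_nonneg_left (map_add_le_add _ _ _) hlam)
      (fun i => LinearMap.proj i ∘ₗ M.mulVecLin) (h - M *ᵥ x) 0 (1 - s)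
      (fun w _ => mul_nonneg hlam (apply_nonneg _ _))
      (fun w hw => by
        have hle := hs (x - w) fun i => by
          have hwi : 0 ≤ (M *ᵥ w) i + (h i - (M *ᵥ x) i) := hw i
          rw [mulVec_sub, Pi.sub_apply]
          linarith
        rw [sub_sub_cancel] at hle
        rw [LinearMap.zero_apply]
        linarith)
    refine ⟨γ, hγ, ?_, fun w => by simpa [dotProduct] using hle w⟩
    change 1 - s + γ ⬝ᵥ (h - M *ᵥ x) ≤ 0 at hval
    linarith
  · rintro ⟨γ, hγ, hval, hle⟩ ξ hξ
    have hγξ : γ ⬝ᵥ (M *ᵥ ξ) ≤ γ ⬝ᵥ h := dotProduct_le_dotProduct_of_nonneg_left hξ hγ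
    have hslope := hle (x - ξ)
    rw [mulVec_sub, dotProduct_sub] at hslope
    rw [dotProduct_sub] at hval
    linarith

theorem forall_mulVec_le_mulVec_le_iff_exists_dualNorm_le {κ : Type*} [Fintype κ]
    (hnrm : ∀ ξ, nrm ξ = 0 → ξ = 0) (A : Matrix κ (Fin m) ℝ) (b : κ → ℝ)
    (C : Matrix ι (Fin m) ℝ) (d : ι → ℝ) (x : Fin m → ℝ) {lam s : ℝ} (hlam : 0 ≤ lam) :
    (∀ ξ, A *ᵥ ξ ≤ b → C *ᵥ ξ ≤ d → 1 - lam * nrm (x - ξ) ≤ s) ↔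
      ∃ (γ : ι → ℝ) (θ : κ → ℝ), 0 ≤ γ ∧ 0 ≤ θ ∧
        1 + θ ⬝ᵥ (b - A *ᵥ x) + γ ⬝ᵥ (d - C *ᵥ x) ≤ s ∧
        dualNorm nrm (Aᵀ *ᵥ θ + Cᵀ *ᵥ γ) ≤ lam := by
  have h_dual := forall_mulVec_le_iff_exists_dualNorm_le hnrm (fromRows A C) (Sum.elim b d) x
    (s := s) hlam
  have h_nonneg : ∀ (θ : κ → ℝ) (γ : ι → ℝ), 0 ≤ Sum.elim θ γ ↔ 0 ≤ θ ∧ 0 ≤ γ := by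
    simp [Pi.le_def]
  have h_elim : ∀ (p : (κ ⊕ ι → ℝ) → Prop), (∃ μ, p μ) ↔ ∃ γ θ, p (Sum.elim θ γ) := fun p =>
    ⟨fun ⟨μ, hμ⟩ => ⟨μ ∘ Sum.inr, μ ∘ Sum.inl, by rwa [Sum.elim_comp_inl_inr]⟩,
      fun ⟨γ, θ, h⟩ => ⟨_, h⟩⟩
  simp only [fromRows_mulVec, Sum.elim_le_elim_iff, and_imp, transpose_fromRows, h_elim,
    fromCols_mulVec_sumElim, ← Sum.elim_sub_sub, sumElim_dotProduct_sumElim, ← add_assoc,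
    h_nonneg] at h_dual
  simp only [h_dual, and_assoc, and_left_comm]

theorem forall_le_dotProduct_mulVec_le_iff_exists_dualNorm_le (hnrm : ∀ ξ, nrm ξ = 0 → ξ = 0)
    (a : Fin m → ℝ) (β : ℝ) (C : Matrix ι (Fin m) ℝ) (d : ι → ℝ) (x : Fin m → ℝ) {lam s : ℝ}
    (hlam : 0 ≤ lam) :
    (∀ ξ, β ≤ a ⬝ᵥ ξ → C *ᵥ ξ ≤ d → 1 - lam * nrm (x - ξ) ≤ s) ↔
      ∃ (γ : ι → ℝ) (θ : ℝ), 0 ≤ γ ∧ 0 ≤ θ ∧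
        1 - θ * (β - a ⬝ᵥ x) + γ ⬝ᵥ (d - C *ᵥ x) ≤ s ∧ dualNorm nrm (θ • a - Cᵀ *ᵥ γ) ≤ lam := by
  have h_dual := forall_mulVec_le_mulVec_le_iff_exists_dualNorm_le hnrm
    (replicateRow Unit (-a)) (fun _ => -β) C d x (s := s) hlam
  have h_row : ∀ ξ, replicateRow Unit (-a) *ᵥ ξ = fun _ => -(a ⬝ᵥ ξ) := fun ξ =>
    funext fun _ => neg_dotProduct a ξ
  have h_const : ∀ p : (Unit → ℝ) → Prop, (∃ θ, p θ) ↔ ∃ t : ℝ, p fun _ => t := fun p =>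
    (Equiv.funUnique Unit ℝ).exists_congr_left
  have h_slope : ∀ (γ : ι → ℝ) (t : ℝ), dualNorm nrm
      ((replicateRow Unit (-a))ᵀ *ᵥ (fun _ => t) + Cᵀ *ᵥ γ) = dualNorm nrm (t • a - Cᵀ *ᵥ γ) := by
    intro γ t
    rw [← dualNorm_neg]
    congr 1
    ext j
    simp only [mulVec, dotProduct, transpose_apply, replicateRow_apply, Fintype.sum_unique,
      Pi.neg_apply, Pi.add_apply, Pi.sub_apply, Pi.smul_apply, smul_eq_mul]
    ring
  have h_term : ∀ t : ℝ, (fun _ : Unit => t) ⬝ᵥ ((fun _ => -β) - fun _ => -(a ⬝ᵥ x)) =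
      -(t * (β - a ⬝ᵥ x)) := fun t => by
    rw [dotProduct, Fintype.sum_unique, Pi.sub_apply]
    ring
  have h_le : ∀ r t : ℝ, ((fun _ : Unit => r) ≤ fun _ => t) ↔ r ≤ t := fun r t =>
    ⟨fun h => h (), fun h _ => h⟩
  have h_nonneg : ∀ t : ℝ, 0 ≤ (fun _ : Unit => t) ↔ 0 ≤ t := h_le 0
  simp only [h_row, h_const, h_slope, h_term, h_nonneg, h_le, neg_le_neg_iff,
    ← sub_eq_add_neg] at h_dual
  exact h_dual

end PolyhedralDuality

section WeakDuality

variable {m : ℕ} {nrm : Seminorm ℝ (Fin m → ℝ)} {T : Set (Fin m → ℝ)} {lam : ℝ}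
  {Q₁ Q₂ : Measure (Fin m → ℝ)}

/-- The Kantorovich potential `x ↦ sup_{ξ ∈ T} (1 - λ ‖x - ξ‖)⁺`, the least function that together
with `λ ‖x - ξ‖` dominates the indicator function of `T` at `ξ`. -/
noncomputable def kantorovichPotential (nrm : Seminorm ℝ (Fin m → ℝ)) (T : Set (Fin m → ℝ))
    (lam : ℝ) (x : Fin m → ℝ) : ℝ≥0∞ :=
  ⨆ ξ ∈ T, ENNReal.ofReal (1 - lam * nrm (x - ξ))

theorem measurable_kantorovichPotential : Measurable (kantorovichPotential nrm T lam) :=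
  (lowerSemicontinuous_biSup fun _ _ => (ENNReal.continuous_ofReal.comp (continuous_const.sub
    (continuous_const.mul ((continuous_seminorm nrm).comp (continuous_id.sub
      continuous_const))))).lowerSemicontinuous).measurable

theorem indicator_one_le_mul_add_kantorovichPotential (hlam : 0 ≤ lam) (x ξ : Fin m → ℝ) :
    T.indicator 1 ξ ≤
      ENNReal.ofReal lam * ENNReal.ofReal (nrm (x - ξ)) + kantorovichPotential nrm T lam x := by
  refine Set.indicator_apply_le' (fun hξ => ?_) fun _ => zero_le
  rw [← ENNReal.ofReal_mul hlam]
  calc (1 : ℝ≥0∞) ≤ ENNReal.ofReal (lam * nrm (x - ξ) + (1 - lam * nrm (x - ξ))) := by simp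
    _ ≤ _ := ENNReal.ofReal_add_le
    _ ≤ _ := add_le_add_right
        (le_iSup₂ (f := fun ξ _ => ENNReal.ofReal (1 - lam * nrm (x - ξ))) ξ hξ) _

theorem measure_le_mul_lintegral_add_of_mem_couplings (hT : MeasurableSet T) (hlam : 0 ≤ lam)
    {P : Measure ((Fin m → ℝ) × (Fin m → ℝ))} (hP : P ∈ couplings Q₁ Q₂) :
    Q₂ T ≤ ENNReal.ofReal lam * ∫⁻ p, ENNReal.ofReal (nrm (p.1 - p.2)) ∂P +
      ∫⁻ x, kantorovichPotential nrm T lam x ∂Q₁ := by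
  have hcost : Measurable fun p : (Fin m → ℝ) × (Fin m → ℝ) => ENNReal.ofReal (nrm (p.1 - p.2)) :=
    ((continuous_seminorm nrm).comp (continuous_fst.sub continuous_snd)).measurable.ennreal_ofReal
  calc Q₂ T = ∫⁻ p, T.indicator 1 p.2 ∂P := by
        rw [← lintegral_indicator_one hT, ← hP.2,
          lintegral_map (measurable_one.indicator hT) measurable_snd]
    _ ≤ ∫⁻ p, ENNReal.ofReal lam * ENNReal.ofReal (nrm (p.1 - p.2)) +
          kantorovichPotential nrm T lam p.1 ∂P :=
        lintegral_mono fun p => indicator_one_le_mul_add_kantorovichPotential hlam p.1 p.2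
    _ = _ := by
        rw [lintegral_add_left (hcost.const_mul _), lintegral_const_mul _ hcost, ← hP.1,
          lintegral_map measurable_kantorovichPotential measurable_fst]

theorem measure_le_mul_wasserstein_add [IsProbabilityMeasure Q₁] [IsProbabilityMeasure Q₂]
    (hT : MeasurableSet T) (hlam : 0 ≤ lam) :
    Q₂ T ≤ ENNReal.ofReal lam * wasserstein nrm Q₁ Q₂ +
      ∫⁻ x, kantorovichPotential nrm T lam x ∂Q₁ := by
  have : Nonempty (couplings Q₁ Q₂) := ⟨Q₁.prod Q₂, by simp, by simp⟩
  rw [wasserstein, iInf_subtype', ENNReal.mul_iInf' (by simp) fun _ => this, ENNReal.iInf_add]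
  exact le_iInf fun P => measure_le_mul_lintegral_add_of_mem_couplings hT hlam P.2

end WeakDuality

section Empirical

variable {m N : ℕ}

theorem lintegral_empirical (ξhat : Fin N → Fin m → ℝ) (f : (Fin m → ℝ) → ℝ≥0∞) :
    ∫⁻ x, f x ∂empirical ξhat = (N : ℝ≥0∞)⁻¹ * ∑ i, f (ξhat i) := by
  rw [empirical, lintegral_smul_measure, lintegral_finsetSum_measure]
  simp [lintegral_dirac]

theorem isProbabilityMeasure_empirical (hN : 0 < N) (ξhat : Fin N → Fin m → ℝ) :
    IsProbabilityMeasure (empirical ξhat) :=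
  ⟨by rw [← setLIntegral_one, Measure.restrict_univ, lintegral_empirical]
      simp [ENNReal.inv_mul_cancel, hN.ne']⟩

theorem inv_natCast_mul_sum_ofReal (hN : 0 < N) {s : Fin N → ℝ} (hs : 0 ≤ s) :
    (N : ℝ≥0∞)⁻¹ * ∑ i, ENNReal.ofReal (s i) = ENNReal.ofReal (1 / (N : ℝ) * ∑ i, s i) := by
  rw [ENNReal.ofReal_mul (by positivity), one_div, ENNReal.ofReal_inv_of_pos (Nat.cast_pos.2 hN),
    ENNReal.ofReal_natCast, ENNReal.ofReal_sum_of_nonneg fun i _ => hs i]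

end Empirical

section TransportPlan

variable {m N : ℕ} {nrm : Seminorm ℝ (Fin m → ℝ)} {Ξ S : Set (Fin m → ℝ)}
  {ξhat η : Fin N → Fin m → ℝ} {p : Fin N → ℝ} {ε : ℝ}

/-- The transport plan that moves the fraction `p i` of the atom `ξhat i` of the empirical
distribution to `η i` and leaves the rest in place. -/
noncomputable def transportPlan (ξhat η : Fin N → Fin m → ℝ) (p : Fin N → ℝ) :
    Measure ((Fin m → ℝ) × (Fin m → ℝ)) :=
  (N : ℝ≥0∞)⁻¹ • ∑ i, (ENNReal.ofReal (1 - p i) • Measure.dirac (ξhat i, ξhat i) +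
    ENNReal.ofReal (p i) • Measure.dirac (ξhat i, η i))

theorem lintegral_transportPlan (ξhat η : Fin N → Fin m → ℝ) (p : Fin N → ℝ)
    (f : (Fin m → ℝ) × (Fin m → ℝ) → ℝ≥0∞) :
    ∫⁻ x, f x ∂transportPlan ξhat η p = (N : ℝ≥0∞)⁻¹ *
      ∑ i, (ENNReal.ofReal (1 - p i) * f (ξhat i, ξhat i) +
        ENNReal.ofReal (p i) * f (ξhat i, η i)) := by
  rw [transportPlan, lintegral_smul_measure, lintegral_finsetSum_measure]
  simp [lintegral_add_measure, lintegral_smul_measure, lintegral_dirac]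

theorem transportPlan_mem_couplings (hp : p ∈ Set.Icc 0 1) :
    transportPlan ξhat η p ∈ couplings (empirical ξhat) (transportPlan ξhat η p).snd := by
  refine ⟨Measure.ext_of_lintegral _ fun f hf => ?_, rfl⟩
  have hmass : ∀ i, ENNReal.ofReal (1 - p i) + ENNReal.ofReal (p i) = 1 := fun i => by
    have hpi : p i ≤ 1 := hp.2 i
    rw [← ENNReal.ofReal_add (sub_nonneg.2 hpi) (hp.1 i), sub_add_cancel, ENNReal.ofReal_one]
  rw [lintegral_map hf measurable_fst, lintegral_transportPlan, lintegral_empirical]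
  simp only [← add_mul, hmass, one_mul]

theorem lintegral_snd_transportPlan {f : (Fin m → ℝ) → ℝ≥0∞} (hf : Measurable f) :
    ∫⁻ x, f x ∂(transportPlan ξhat η p).snd = (N : ℝ≥0∞)⁻¹ *
      ∑ i, (ENNReal.ofReal (1 - p i) * f (ξhat i) + ENNReal.ofReal (p i) * f (η i)) := by
  rw [Measure.snd, lintegral_map hf measurable_snd, lintegral_transportPlan]

theorem snd_transportPlan_apply {T : Set (Fin m → ℝ)} (hT : MeasurableSet T) :
    (transportPlan ξhat η p).snd T = (N : ℝ≥0∞)⁻¹ * ∑ i,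
      (ENNReal.ofReal (1 - p i) * T.indicator 1 (ξhat i) +
        ENNReal.ofReal (p i) * T.indicator 1 (η i)) := by
  rw [← lintegral_indicator_one hT, lintegral_snd_transportPlan (measurable_one.indicator hT)]

theorem snd_transportPlan_mem_finiteMoment (hN : 0 < N) (hΞ : MeasurableSet Ξ)
    (hξhat : ∀ i, ξhat i ∈ Ξ) (hη : ∀ i, η i ∈ Ξ) (hp : p ∈ Set.Icc 0 1) :
    (transportPlan ξhat η p).snd ∈ finiteMoment nrm Ξ := by
  refine ⟨⟨?_⟩, ?_, ?_⟩
  · have := isProbabilityMeasure_empirical hN ξhat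
    rw [Measure.snd_univ, ← Measure.fst_univ, Measure.fst, (transportPlan_mem_couplings hp).1,
      measure_univ]
  · simp [snd_transportPlan_apply hΞ.compl, hξhat, hη]
  · rw [lintegral_snd_transportPlan (continuous_seminorm nrm).measurable.ennreal_ofReal]
    refine ENNReal.mul_lt_top (by simp [hN]) (ENNReal.sum_lt_top.2 fun i _ => ?_)
    simp only [← ENNReal.ofReal_mul' (apply_nonneg nrm _)]
    exact ENNReal.add_lt_top.2 ⟨ENNReal.ofReal_lt_top, ENNReal.ofReal_lt_top⟩

theorem wasserstein_snd_transportPlan_le (hN : 0 < N) (hp : p ∈ Set.Icc 0 1) :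
    wasserstein nrm (empirical ξhat) (transportPlan ξhat η p).snd ≤
      ENNReal.ofReal (1 / (N : ℝ) * ∑ i, p i * nrm (ξhat i - η i)) := by
  refine (iInf₂_le _ (transportPlan_mem_couplings hp)).trans_eq ?_
  rw [lintegral_transportPlan, ← inv_natCast_mul_sum_ofReal hN fun i =>
    mul_nonneg (hp.1 i) (apply_nonneg _ _)]
  simp [ENNReal.ofReal_mul (hp.1 _)]

theorem ofReal_le_snd_transportPlan_apply (hN : 0 < N) (hS : MeasurableSet S) (hη : ∀ i, η i ∈ S)
    (hp : 0 ≤ p) :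
    ENNReal.ofReal (1 / (N : ℝ) * ∑ i, p i) ≤ (transportPlan ξhat η p).snd S := by
  rw [snd_transportPlan_apply hS, ← inv_natCast_mul_sum_ofReal hN hp]
  gcongr with i
  simp [hη i]

theorem snd_transportPlan_mem_wassersteinBall (hN : 0 < N) (hΞ : MeasurableSet Ξ)
    (hξhat : ∀ i, ξhat i ∈ Ξ) (hη : ∀ i, η i ∈ Ξ) (hp : p ∈ Set.Icc 0 1)
    (hcost : ∑ i, p i * nrm (ξhat i - η i) ≤ N * ε) :
    (transportPlan ξhat η p).snd ∈ wassersteinBall nrm Ξ (empirical ξhat) ε := by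
  refine ⟨snd_transportPlan_mem_finiteMoment hN hΞ hξhat hη hp,
    (wasserstein_snd_transportPlan_le hN hp).trans (ENNReal.ofReal_le_ofReal ?_)⟩
  rwa [one_div, inv_mul_le_iff₀ (Nat.cast_pos.2 hN)]

theorem le_supProb_of_transport (hN : 0 < N) (hS : MeasurableSet S) (hΞ : MeasurableSet Ξ)
    (hξhat : ∀ i, ξhat i ∈ Ξ) (hη : ∀ i, η i ∈ S ∩ Ξ) (hp : p ∈ Set.Icc 0 1)
    (hcost : ∑ i, p i * nrm (ξhat i - η i) ≤ N * ε) :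
    ((1 / (N : ℝ) * ∑ i, p i : ℝ) : EReal) ≤ supProb nrm Ξ ξhat ε S := by
  have hball : (transportPlan ξhat η p).snd ∈ wassersteinBall nrm Ξ (empirical ξhat) ε :=
    snd_transportPlan_mem_wassersteinBall hN hΞ hξhat (fun i => (hη i).2) hp hcost
  calc ((1 / (N : ℝ) * ∑ i, p i : ℝ) : EReal)
      ≤ (ENNReal.ofReal (1 / (N : ℝ) * ∑ i, p i) : EReal) := by
        rw [EReal.coe_ennreal_ofReal]
        exact EReal.coe_le_coe_iff.2 (le_max_left _ _)
    _ ≤ ((transportPlan ξhat η p).snd S : EReal) := EReal.coe_ennreal_le_coe_ennreal_iff.2 <|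
        ofReal_le_snd_transportPlan_apply hN hS (fun i => (hη i).1) hp.1
    _ ≤ supProb nrm Ξ ξhat ε S :=
        le_iSup₂ (f := fun Q _ => ((Q S : ℝ≥0∞) : EReal)) _ hball

theorem supProb_nonneg (hN : 0 < N) (hΞ : MeasurableSet Ξ) (hξhat : ∀ i, ξhat i ∈ Ξ)
    (hε : 0 ≤ ε) : 0 ≤ supProb nrm Ξ ξhat ε S := by
  have hball : (transportPlan ξhat ξhat 0).snd ∈ wassersteinBall nrm Ξ (empirical ξhat) ε :=
    snd_transportPlan_mem_wassersteinBall hN hΞ hξhat hξhat ⟨le_rfl, zero_le_one⟩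
      (by simpa using mul_nonneg (Nat.cast_nonneg N) hε)
  exact le_iSup₂_of_le (f := fun Q _ => ((Q S : ℝ≥0∞) : EReal)) _ hball
    (EReal.coe_ennreal_nonneg _)

end TransportPlan

section StrongDuality

variable {m N : ℕ} {nrm : Seminorm ℝ (Fin m → ℝ)} {Ξ S T : Set (Fin m → ℝ)}
  {ξhat : Fin N → Fin m → ℝ} {ε lam : ℝ} {s : Fin N → ℝ}

/-- Feasibility in the semi-infinite dual of the problem of maximizing, over a Wasserstein ball
around the empirical distribution of `ξhat`, the probability of a set `T`: `lam` is the price of the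
transport budget, and `s i` that of the mass of the atom `ξhat i`. -/
structure DualFeasible (nrm : Seminorm ℝ (Fin m → ℝ)) (T : Set (Fin m → ℝ))
    (ξhat : Fin N → Fin m → ℝ) (lam : ℝ) (s : Fin N → ℝ) : Prop where
  lam_nonneg : 0 ≤ lam
  s_nonneg : 0 ≤ s
  epigraph : ∀ i, ∀ ξ ∈ T, 1 - lam * nrm (ξhat i - ξ) ≤ s i

theorem DualFeasible.lintegral_kantorovichPotential_le (hN : 0 < N)
    (h : DualFeasible nrm T ξhat lam s) :
    ∫⁻ x, kantorovichPotential nrm T lam x ∂empirical ξhat ≤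
      ENNReal.ofReal (1 / (N : ℝ) * ∑ i, s i) := by
  rw [lintegral_empirical, ← inv_natCast_mul_sum_ofReal hN h.s_nonneg]
  gcongr with i
  exact iSup₂_le fun ξ hξ => ENNReal.ofReal_le_ofReal (h.epigraph i ξ hξ)

theorem DualFeasible.supProb_le (hN : 0 < N) (hS : MeasurableSet (S ∩ Ξ)) (hε : 0 ≤ ε)
    (h : DualFeasible nrm (S ∩ Ξ) ξhat lam s) :
    supProb nrm Ξ ξhat ε S ≤ ((lam * ε + 1 / (N : ℝ) * ∑ i, s i : ℝ) : EReal) := by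
  refine iSup₂_le fun Q ⟨⟨hQ, hQΞ, _⟩, hW⟩ => ?_
  have := isProbabilityMeasure_empirical hN ξhat
  have hsum : 0 ≤ 1 / (N : ℝ) * ∑ i, s i :=
    mul_nonneg (by positivity) (Finset.sum_nonneg fun i _ => h.s_nonneg i)
  have hval : 0 ≤ lam * ε := mul_nonneg h.lam_nonneg hε
  have hle : Q S ≤ ENNReal.ofReal (lam * ε + 1 / (N : ℝ) * ∑ i, s i) := calc
    Q S = Q (S ∩ Ξ) := (measure_inter_conull hQΞ).symm
    _ ≤ ENNReal.ofReal lam * wasserstein nrm (empirical ξhat) Q +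
        ∫⁻ x, kantorovichPotential nrm (S ∩ Ξ) lam x ∂empirical ξhat :=
      measure_le_mul_wasserstein_add hS h.lam_nonneg
    _ ≤ ENNReal.ofReal lam * ENNReal.ofReal ε + ENNReal.ofReal (1 / (N : ℝ) * ∑ i, s i) := by
      gcongr
      exact h.lintegral_kantorovichPotential_le hN
    _ = _ := by rw [← ENNReal.ofReal_mul h.lam_nonneg, ENNReal.ofReal_add hval hsum]
  calc (Q S : EReal) ≤ (ENNReal.ofReal (lam * ε + 1 / (N : ℝ) * ∑ i, s i) : EReal) :=
        EReal.coe_ennreal_le_coe_ennreal_iff.2 hle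
    _ = _ := by rw [EReal.coe_ennreal_ofReal, max_eq_left (add_nonneg hval hsum)]

theorem exists_dualFeasible_le_supProb (hN : 0 < N) (hnrm : ∀ ξ, nrm ξ = 0 → ξ = 0)
    (hS : MeasurableSet S) (hΞ : MeasurableSet Ξ) (hSΞ : IsClosed (S ∩ Ξ))
    (hξhat : ∀ i, ξhat i ∈ Ξ) (hε : 0 ≤ ε) :
    ∃ lam s, DualFeasible nrm (S ∩ Ξ) ξhat lam s ∧
      ((lam * ε + 1 / (N : ℝ) * ∑ i, s i : ℝ) : EReal) ≤ supProb nrm Ξ ξhat ε S := by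
  obtain hempty | hne := (S ∩ Ξ).eq_empty_or_nonempty
  · refine ⟨0, 0, ⟨le_rfl, le_rfl, by simp [hempty]⟩, ?_⟩
    simpa using supProb_nonneg hN hΞ hξhat hε
  choose η hη hmin using fun i => exists_isMinOn_seminorm_sub hnrm hSΞ hne (ξhat i)
  obtain ⟨p, ⟨hp, hcost⟩, lam, hlam, s, hs, hle, hval⟩ := exists_knapsack_dual_le
    (1 : Fin N → ℝ) (fun i => nrm (ξhat i - η i)) (mul_nonneg (Nat.cast_nonneg N) hε)
  refine ⟨lam, s, ⟨hlam, hs, fun i ξ hξ => (hle i).trans' ?_⟩, ?_⟩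
  · exact sub_le_sub_left (mul_le_mul_of_nonneg_left (hmin i hξ) hlam) 1
  refine le_trans ?_ (le_supProb_of_transport hN hS hΞ hξhat hη hp
    (by simpa only [dotProduct, mul_comm] using hcost))
  have hN' : (0 : ℝ) < N := Nat.cast_pos.2 hN
  rw [one_dotProduct] at hval
  rw [EReal.coe_le_coe_iff, one_div, le_inv_mul_iff₀ hN', mul_add,
    mul_inv_cancel_left₀ hN'.ne', mul_left_comm]
  exact hval

theorem supProb_eq_iInf_dualFeasible (hN : 0 < N) (hnrm : ∀ ξ, nrm ξ = 0 → ξ = 0)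
    (hS : MeasurableSet S) (hΞ : MeasurableSet Ξ) (hSΞ : IsClosed (S ∩ Ξ))
    (hξhat : ∀ i, ξhat i ∈ Ξ) (hε : 0 ≤ ε) :
    supProb nrm Ξ ξhat ε S = ⨅ (lam : ℝ) (s : Fin N → ℝ) (_ : DualFeasible nrm (S ∩ Ξ) ξhat lam s),
      ((lam * ε + 1 / (N : ℝ) * ∑ i, s i : ℝ) : EReal) := by
  refine le_antisymm (le_iInf₂ fun lam s => le_iInf fun h =>
    h.supProb_le hN (hS.inter hΞ) hε) ?_
  obtain ⟨lam, s, h, hle⟩ := exists_dualFeasible_le_supProb hN hnrm hS hΞ hSΞ hξhat hε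
  exact iInf₂_le_of_le lam s (iInf_le_of_le h hle)

end StrongDuality

section Polyhedra

variable {m N J K : ℕ} {nrm : Seminorm ℝ (Fin m → ℝ)} {ξhat : Fin N → Fin m → ℝ} {lam : ℝ}
  {s : Fin N → ℝ}

theorem isClosed_closedPolytope (C : Matrix (Fin J) (Fin m) ℝ) (d : Fin J → ℝ) :
    IsClosed (closedPolytope C d) :=
  isClosed_le (continuous_const.matrix_mulVec continuous_id) continuous_const

theorem isOpen_openPolytope (A : Matrix (Fin K) (Fin m) ℝ) (b : Fin K → ℝ) :
    IsOpen (openPolytope A b) := by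
  simp only [openPolytope, Set.ofPred_forall]
  exact isOpen_iInter_of_finite fun k => isOpen_lt
    ((continuous_apply k).comp (continuous_const.matrix_mulVec continuous_id)) continuous_const

theorem mem_compl_openPolytope {A : Matrix (Fin K) (Fin m) ℝ} {b : Fin K → ℝ} {ξ : Fin m → ℝ} :
    ξ ∈ (openPolytope A b)ᶜ ↔ ∃ k, b k ≤ A k ⬝ᵥ ξ := by
  simp [openPolytope, mulVec]

theorem dualFeasible_iff_exists_worstFeasible (hN : 0 < N) (hK : 0 < K)
    (hnrm : ∀ ξ, nrm ξ = 0 → ξ = 0) (C : Matrix (Fin J) (Fin m) ℝ) (d : Fin J → ℝ)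
    (A : Matrix (Fin K) (Fin m) ℝ) (b : Fin K → ℝ) :
    DualFeasible nrm ((openPolytope A b)ᶜ ∩ closedPolytope C d) ξhat lam s ↔
      ∃ γ θ, WorstFeasible nrm C d A b ξhat lam s γ θ := by
  have h_block := fun (hlam : 0 ≤ lam) i k => forall_le_dotProduct_mulVec_le_iff_exists_dualNorm_le
    hnrm (A k) (b k) C d (ξhat i) (s := s i) hlam
  constructor
  · intro h
    choose γ θ hγ hθ h_epi h_slope using fun i k => (h_block h.lam_nonneg i k).1 fun ξ hk hξ =>
      h.epigraph i ξ ⟨mem_compl_openPolytope.2 ⟨k, hk⟩, hξ⟩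
    exact ⟨γ, θ, h_epi, h_slope, hγ, hθ, h.s_nonneg⟩
  · rintro ⟨γ, θ, h⟩
    have hlam : 0 ≤ lam := (dualNorm_nonneg hnrm _).trans (h.slope ⟨0, hN⟩ ⟨0, hK⟩)
    refine ⟨hlam, h.s_nonneg, fun i ξ ⟨hξA, hξC⟩ => ?_⟩
    obtain ⟨k, hk⟩ := mem_compl_openPolytope.1 hξA
    exact (h_block hlam i k).2 ⟨γ i k, θ i k, h.γ_nonneg i k, h.θ_nonneg i k, h.epigraph i k,
      h.slope i k⟩ ξ hk hξC

theorem dualFeasible_iff_exists_bestFeasible (hN : 0 < N) (hnrm : ∀ ξ, nrm ξ = 0 → ξ = 0)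
    (C : Matrix (Fin J) (Fin m) ℝ) (d : Fin J → ℝ)
    (A : Matrix (Fin K) (Fin m) ℝ) (b : Fin K → ℝ) :
    DualFeasible nrm (closedPolytope A b ∩ closedPolytope C d) ξhat lam s ↔
      ∃ γ θ, BestFeasible nrm C d A b ξhat lam s γ θ := by
  have h_block := fun (hlam : 0 ≤ lam) i => forall_mulVec_le_mulVec_le_iff_exists_dualNorm_le
    hnrm A b C d (ξhat i) (s := s i) hlam
  constructor
  · intro h
    choose γ θ hγ hθ h_epi h_slope using fun i => (h_block h.lam_nonneg i).1 fun ξ hA hξ =>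
      h.epigraph i ξ ⟨hA, hξ⟩
    exact ⟨γ, θ, h_epi, h_slope, hγ, hθ, h.s_nonneg⟩
  · rintro ⟨γ, θ, h⟩
    have hlam : 0 ≤ lam := (dualNorm_nonneg hnrm _).trans (h.slope ⟨0, hN⟩)
    exact ⟨hlam, h.s_nonneg, fun i ξ ⟨hξA, hξC⟩ => (h_block hlam i).2
      ⟨γ i, θ i, h.γ_nonneg i, h.θ_nonneg i, h.epigraph i, h.slope i⟩ ξ hξA hξC⟩

end Polyhedra

end WassersteinUQ

theorem mainTheorem7_general {m N J K : ℕ} (hN : 0 < N)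
    (nrm : Seminorm ℝ (Fin m → ℝ)) (hnrm : ∀ ξ, nrm ξ = 0 → ξ = 0)
    (C : Matrix (Fin J) (Fin m) ℝ) (d : Fin J → ℝ)
    (A : Matrix (Fin K) (Fin m) ℝ) (b : Fin K → ℝ)
    (ξhat : Fin N → Fin m → ℝ) (hξhat : ∀ i, ξhat i ∈ closedPolytope C d)
    (ε : ℝ) (hε : 0 ≤ ε) :
    (0 < K → supProb nrm (closedPolytope C d) ξhat ε (openPolytope A b)ᶜ =
      worstValue nrm C d A b ξhat ε) ∧
    supProb nrm (closedPolytope C d) ξhat ε (closedPolytope A b) =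
      bestValue nrm C d A b ξhat ε := by
  have hΞ := isClosed_closedPolytope C d
  constructor
  · intro hK
    have hS := (isOpen_openPolytope A b).isClosed_compl
    rw [supProb_eq_iInf_dualFeasible hN hnrm hS.measurableSet hΞ.measurableSet (hS.inter hΞ)
      hξhat hε]
    simp only [dualFeasible_iff_exists_worstFeasible hN hK hnrm, iInf_exists, worstValue]
  · have hS := isClosed_closedPolytope A b
    rw [supProb_eq_iInf_dualFeasible hN hnrm hS.measurableSet hΞ.measurableSet (hS.inter hΞ)
      hξhat hε]
    simp only [dualFeasible_iff_exists_bestFeasible hN hnrm, iInf_exists, bestValue]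

theorem mainTheorem7 {m N J K : ℕ} (hN : 0 < N)
    (nrm : Seminorm ℝ (Fin m → ℝ)) (hnrm : ∀ ξ, nrm ξ = 0 → ξ = 0)
    (C : Matrix (Fin J) (Fin m) ℝ) (d : Fin J → ℝ)
    (A : Matrix (Fin K) (Fin m) ℝ) (b : Fin K → ℝ)
    (ξhat : Fin N → Fin m → ℝ) (hξhat : ∀ i, ξhat i ∈ closedPolytope C d)
    (ε : ℝ) (hε : 0 ≤ ε) :
    (0 < K →
      (∀ k, ({ξ | b k ≤ A k ⬝ᵥ ξ} ∩ closedPolytope C d).Nonempty) →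
      supProb nrm (closedPolytope C d) ξhat ε (openPolytope A b)ᶜ =
        worstValue nrm C d A b ξhat ε) ∧
    ((closedPolytope A b ∩ closedPolytope C d).Nonempty →
      supProb nrm (closedPolytope C d) ξhat ε (closedPolytope A b) =
        bestValue nrm C d A b ξhat ε) := by
  have h := mainTheorem7_general hN nrm hnrm C d A b ξhat hξhat ε hε
  exact ⟨fun hK _ => h.1 hK, fun _ => h.2⟩
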